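/- Let $\Omega$ be a finite nonempty set, let $F,\tilde F\in\mathbb{R}^{\Omega\times\Omega}$ be (row-)stochastic matrices, and let $S\in\mathbb{R}^{\Omega\times\Omega}$ be irreducible and substochastic, i.e. $S_{ij}\ge 0$, $\sum_{j\in\Omega}S_{ij}\le 1$ for all $i$, and for all $i,j\in\Omega$ there is $k\ge 1$ with $(S^k)_{ij}>0$. Assume $F_{ij}\ge S_{ij}$ and $\tilde F_{ij}\ge S_{ij}$ for all $i,j\in\Omega$. Let $X$ be the Markov chain on $\Omega\cup\{\omega\}$ with transition matrix $S^\omega$ given by $S^\omega_{ij}=S_{ij}$, $S^\omega_{i\omega}=1-\sum_{j\in\Omega}S_{ij}$, $S^\omega_{\omega i}=0$ for $i,j\in\Omega$, and $S^\omega_{\omega\omega}=1$, so that $\omega$ is absorbing. Let $\tau_k=\min\{s>0: X_s=k\}$ (with $\min\emptyset=\infty$) and, for $i\neq j$ in $\Omega$, let $$\mathbf{Q}_{ij}(S)=\mathbf{P}\big[\tau_j<\min\{\tau_i,\tau_\omega\}\,\big|\,X_0=i\big].$$ Then $F$ and $\tilde F$ have unique invariant distributions: for $G\in\{F,\tilde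 F\}$ there is exactly one $\pi(G)\in\mathbb{R}^\Omega$ with $\pi(G)^{\mathsf T}G=\pi(G)^{\mathsf T}$ and $\sum_{m\in\Omega}\pi_m(G)=1$. Moreover $\pi_m(F)>0$ and $\pi_m(\tilde F)>0$ for every $m\in\Omega$, $\mathbf{Q}_{ij}(S)>0$ for all $i\ne j$, and for every $m\in\Omega$ $$\left|\log\pi_m(\tilde F)-\log\pi_m(F)\right|\le\sum_{\substack{i,j\in\Omega\\ i\neq j}}\left|\log\big(\tilde F_{ij}-S_{ij}+\mathbf{Q}_{ij}(S)\big)-\log\big(F_{ij}-S_{ij}+\mathbf{Q}_{ij}(S)\big)\right|.$$ -/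

import Mathlib

open MeasureTheory ProbabilityTheory

namespace MarkovPerturbation

/-- A row-substochastic matrix: nonnegative entries and row sums at most one.
Stochastic matrices are included. -/
def IsSubstochastic {Ω : Type*} [Fintype Ω] (S : Matrix Ω Ω ℝ) : Prop :=
  (∀ i j, 0 ≤ S i j) ∧ ∀ i, ∑ j, S i j ≤ 1

/-- `p` is an invariant distribution of `F`: a solution of `pᵀ F = pᵀ` and `∑ m, p m = 1`.
Nonnegativity is not part of the definition; that makes uniqueness stronger. -/
def IsInvariantDistribution {Ω : Type*} [Fintype Ω] (F : Matrix Ω Ω ℝ) (p : Ω → ℝ) : Prop :=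
  Matrix.vecMul p F = p ∧ ∑ m, p m = 1

/-! ### The Markov chain with a given stochastic transition matrix -/

section Chain

variable {α : Type*} [Fintype α] [DecidableEq α] [MeasurableSpace α] [DiscreteMeasurableSpace α]

/-- The one-step transition law of a stochastic matrix from state `a`: state `b` has
mass `P a b`. -/
noncomputable def stepLaw (P : Matrix α α ℝ) (a : α) : Measure α :=
  ∑ b, ENNReal.ofReal (P a b) • Measure.dirac b

/-- The one-step transition kernel of a stochastic matrix. -/
noncomputable def stepKernel (P : Matrix.rowStochastic ℝ α) : Kernel α α where
  toFun := stepLaw P.1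
  measurable' := Measurable.of_discrete

instance (P : Matrix.rowStochastic ℝ α) : IsMarkovKernel (stepKernel P) where
  isProbabilityMeasure a := ⟨by
    have h := Matrix.mem_rowStochastic_iff_sum.1 P.2
    simp only [stepKernel, stepLaw, Kernel.coe_mk, Measure.coe_finsetSum, Measure.coe_smul,
      Finset.sum_apply, Pi.smul_apply, measure_univ, smul_eq_mul, mul_one]
    rw [← ENNReal.ofReal_sum_of_nonneg (fun b _ => h.1 a b), h.2 a, ENNReal.ofReal_one]⟩

/-- The kernel giving the law of `X (n + 1)` from the history `(X 0, …, X n)` of a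
time-homogeneous Markov chain: it depends on `X n` only. -/
noncomputable def historyKernel (P : Matrix.rowStochastic ℝ α) (n : ℕ) :
    Kernel ((_ : Finset.Iic n) → α) α :=
  (stepKernel P).comap (fun x => x ⟨n, Finset.mem_Iic.2 le_rfl⟩) (measurable_pi_apply _)

instance (P : Matrix.rowStochastic ℝ α) (n : ℕ) : IsMarkovKernel (historyKernel P n) := by
  unfold historyKernel; infer_instance

/-- The law, on the space `ℕ → α` of trajectories, of the Markov chain with transition
matrix `P` started at `a`. -/
noncomputable def chainLaw (P : Matrix.rowStochastic ℝ α) (a : α) : Measure (ℕ → α) :=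
  Kernel.traj (X := fun _ => α) (historyKernel P) 0 (fun _ => a)

end Chain

/-- The first return time `τ_k = min {s > 0 : X_s = k}` of a trajectory to the state `k`,
equal to `⊤` if there is no such `s`. -/
noncomputable def returnTime {α : Type*} (k : α) : (ℕ → α) → WithTop ℕ :=
  hittingAfter (fun s x => x s) {k} 1

/-! ### Augmentation by an absorbing state -/

/-- Finite state spaces augmented by an absorbing state carry the discrete σ-algebra. -/
instance {Ω : Type*} : MeasurableSpace (Option Ω) := ⊤

instance {Ω : Type*} : DiscreteMeasurableSpace (Option Ω) := ⟨fun _ => trivial⟩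

/-- The transition matrix `S^ω` on `Ω ∪ {ω}`; the absorbing state `ω` is `none`. -/
def augment {Ω : Type*} [Fintype Ω] (S : Matrix Ω Ω ℝ) : Matrix (Option Ω) (Option Ω) ℝ
  | some i, some j => S i j
  | some i, none => 1 - ∑ j, S i j
  | none, some _ => 0
  | none, none => 1

theorem augment_mem_rowStochastic {Ω : Type*} [Fintype Ω] [DecidableEq Ω]
    {S : Matrix Ω Ω ℝ} (hS : IsSubstochastic S) :
    augment S ∈ Matrix.rowStochastic ℝ (Option Ω) := by
  rw [Matrix.mem_rowStochastic_iff_sum]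
  constructor
  · rintro (_ | i) (_ | j)
    · simp [augment]
    · simp [augment]
    · simpa [augment] using hS.2 i
    · simpa [augment] using hS.1 i j
  · rintro (_ | i) <;> simp [augment, Fintype.sum_option]

/-- `Q_ij(S)`: the probability that the chain with transition matrix `S^ω` started at `i`
reaches `j` before it returns to `i` or is absorbed at `ω`, that is,
`P_i[τ_j < min {τ_i, τ_ω}](S^ω)`. -/
noncomputable def Q {Ω : Type*} [Fintype Ω] [DecidableEq Ω] (S : Matrix Ω Ω ℝ)
    (hS : IsSubstochastic S) (i j : Ω) : ℝ :=
  (chainLaw ⟨augment S, augment_mem_rowStochastic hS⟩ (some i)).real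
    {x | returnTime (some j) x < min (returnTime (some i) x) (returnTime none x)}

end MarkovPerturbation

/-! Suppose mass `t` is moved from entry `(i, i)` of a stochastic `G ≥ S` to `(i, j)`. The invariant
measure normalised to one at `i` is `w = G i · N`, where `N = green G i` does not see row `i`, so
`w` changes by `t (N j m - N i m) ≥ 0`. An excursion from `i` reaches `j` with probability at least
`c = G i j - S i j + Q i j`, so `w m ≥ c N j m` (`mul_green_le_excursionMeasure`). Thus `log (w m)`
and the log of the total mass both increase, by at most `log (c + t) - log c`; their difference, the
log of the invariant distribution, moves by no more than that (`abs_log_sub_log_le_of_updateRow`).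

Let `C` be the stochastic matrix with off-diagonal entries `min F F'`. Raising its entries one at a
time leads to `F` and to `F'`, the bounds telescope, and for each `(i, j)` at most one of the two
paths contributes. -/

namespace MarkovPerturbation

/-! ### Taboo probabilities and first-passage series. -/

section Taboo

variable {α : Type*} [Fintype α] [DecidableEq α] [MeasurableSpace α] [DiscreteMeasurableSpace α]

instance (P : Matrix.rowStochastic ℝ α) (a : α) : IsProbabilityMeasure (chainLaw P a) := by
  unfold chainLaw; infer_instance

theorem stepKernel_singleton (P : Matrix.rowStochastic ℝ α) (a b : α) :
    stepKernel P a {b} = ENNReal.ofReal (P.1 a b) := by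
  simp [stepKernel, stepLaw, Measure.finsetSum_apply, Set.indicator_apply]

/-- The Markov property for events determined by the first `n` steps. -/
theorem chainLaw_cylinder_succ (P : Matrix.rowStochastic ℝ α) (a : α) (n : ℕ)
    (A : Set ((_ : Finset.Iic n) → α)) (l k : α)
    (hA : ∀ x ∈ A, x ⟨n, Finset.mem_Iic.2 le_rfl⟩ = l) :
    chainLaw P a {x | Preorder.frestrictLe n x ∈ A ∧ x (n + 1) = k} =
      chainLaw P a {x | Preorder.frestrictLe n x ∈ A} * ENNReal.ofReal (P.1 l k) := by
  have hAm : MeasurableSet A := A.toFinite.measurableSet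
  have h := Kernel.partialTraj_compProd_eq_map_traj (X := fun _ => α) (κ := historyKernel P)
    (a := 0) (b := n) n.zero_le (x₀ := fun _ => a)
  have h1 : chainLaw P a {x | Preorder.frestrictLe n x ∈ A ∧ x (n + 1) = k} =
      ((chainLaw P a).map (fun x ↦ (Preorder.frestrictLe n x, x (n + 1)))) (A ×ˢ {k}) := by
    rw [Measure.map_apply (by fun_prop) (hAm.prod (measurableSet_singleton k))]
    rfl
  have h2 : chainLaw P a {x | Preorder.frestrictLe n x ∈ A} =
      Kernel.partialTraj (X := fun _ => α) (historyKernel P) 0 n (fun _ => a) A := by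
    rw [← Kernel.traj_map_frestrictLe_apply, Measure.map_apply (by fun_prop) hAm]
    rfl
  rw [h1, h2, chainLaw, ← h, Measure.compProd_apply_prod hAm (measurableSet_singleton k)]
  rw [setLIntegral_congr_fun (g := fun _ => ENNReal.ofReal (P.1 l k)) hAm, setLIntegral_const,
    mul_comm]
  intro x hx
  simp only [historyKernel, Kernel.comap_apply]
  rw [stepKernel_singleton, hA x hx]

/-- The probability of being at `k` at time `n`, with no visit to `T` at the times strictly
between `0` and `n`. -/
noncomputable def tabooProb (P : Matrix.rowStochastic ℝ α) (a : α) (T : Finset α) (n : ℕ)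
    (k : α) : ℝ :=
  (chainLaw P a).real {x | x n = k ∧ ∀ r, 1 ≤ r → r < n → x r ∉ T}

theorem tabooProb_nonneg (P : Matrix.rowStochastic ℝ α) (a : α) (T : Finset α) (n : ℕ) (k : α) :
    0 ≤ tabooProb P a T n k := measureReal_nonneg

theorem measurableSet_taboo {α : Type*} [MeasurableSpace α] [DiscreteMeasurableSpace α]
    (T : Finset α) (n : ℕ) (k : α) :
    MeasurableSet {x : ℕ → α | x n = k ∧ ∀ r, 1 ≤ r → r < n → x r ∉ T} := by
  have h (r : ℕ) (s : Set α) : MeasurableSet {x : ℕ → α | x r ∈ s} :=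
    measurable_pi_apply r (MeasurableSet.of_discrete (s := s))
  refine (h n {k}).inter ?_
  have h1 : {x : ℕ → α | ∀ r, 1 ≤ r → r < n → x r ∉ T} =
      ⋂ r, ⋂ (_ : 1 ≤ r), ⋂ (_ : r < n), {x : ℕ → α | x r ∈ {y | y ∉ T}} := by
    ext x; simp
  change MeasurableSet {x : ℕ → α | ∀ r, 1 ≤ r → r < n → x r ∉ T}
  rw [h1]
  exact .iInter fun r => .iInter fun _ => .iInter fun _ => h r {y | y ∉ T}

theorem tabooProb_one (P : Matrix.rowStochastic ℝ α) (a : α) (T : Finset α) (k : α) :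
    tabooProb P a T 1 k = P.1 a k := by
  have h := Kernel.map_traj_succ_self (X := fun _ => α) (κ := historyKernel P) (a := 0)
  have h1 : chainLaw P a {x | x 1 = k} = ENNReal.ofReal (P.1 a k) := by
    have h2 : (chainLaw P a).map (fun x => x 1) {k} = ENNReal.ofReal (P.1 a k) := by
      rw [chainLaw, ← Kernel.map_apply _ (by fun_prop)]
      rw [zero_add] at h
      rw [h, historyKernel, Kernel.comap_apply, stepKernel_singleton]
    rw [← h2, Measure.map_apply (by fun_prop) (measurableSet_singleton k)]
    rfl
  have h3 : {x : ℕ → α | x 1 = k ∧ ∀ r, 1 ≤ r → r < 1 → x r ∉ T} = {x | x 1 = k} := by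
    ext x
    simp only [Set.mem_ofPred_eq, and_iff_left_iff_imp]
    intros; omega
  rw [tabooProb, h3, Measure.real, h1,
    ENNReal.toReal_ofReal ((Matrix.mem_rowStochastic_iff_sum.1 P.2).1 a k)]

/-- Split by the position at time `n`. The condition `1 ≤ n` is needed because the taboo does not
apply at time `0`: in the application the starting state lies in `T`. -/
theorem tabooProb_succ (P : Matrix.rowStochastic ℝ α) (a : α) (T : Finset α) {n : ℕ}
    (hn : 1 ≤ n) (k : α) :
    tabooProb P a T (n + 1) k = ∑ l ∈ Tᶜ, tabooProb P a T n l * P.1 l k := by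
  set B : α → Set (ℕ → α) := fun l => {x | x n = l ∧ ∀ r, 1 ≤ r → r < n → x r ∉ T}
  have hset : {x : ℕ → α | x (n + 1) = k ∧ ∀ r, 1 ≤ r → r < n + 1 → x r ∉ T} =
      ⋃ l ∈ Tᶜ, B l ∩ {x | x (n + 1) = k} := by
    ext x
    simp only [Set.mem_ofPred_eq, Set.mem_iUnion, Finset.mem_compl, Set.mem_inter_iff, B]
    constructor
    · rintro ⟨h1, h2⟩
      exact ⟨x n, h2 n hn n.lt_succ_self, ⟨rfl, fun r hr hr' => h2 r hr (by omega)⟩, h1⟩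
    · rintro ⟨l, hl, ⟨rfl, h2⟩, h1⟩
      refine ⟨h1, fun r hr hr' => ?_⟩
      rcases Nat.lt_succ_iff_lt_or_eq.1 hr' with h | rfl
      · exact h2 r hr h
      · exact hl
  have hk : MeasurableSet {x : ℕ → α | x (n + 1) = k} :=
    (measurable_pi_apply (n + 1) : Measurable fun x : ℕ → α => x (n + 1))
      (measurableSet_singleton k)
  rw [tabooProb, hset, measureReal_biUnion_finset]
  · refine Finset.sum_congr rfl fun l _ => ?_
    have h := chainLaw_cylinder_succ P a n
      {y | y ⟨n, Finset.mem_Iic.2 le_rfl⟩ = l ∧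
        ∀ r : Finset.Iic n, 1 ≤ r.1 → r.1 < n → y r ∉ T} l k fun x hx => hx.1
    have h1 : {x : ℕ → α | Preorder.frestrictLe n x ∈ {y : (_ : Finset.Iic n) → α |
        y ⟨n, Finset.mem_Iic.2 le_rfl⟩ = l ∧
        ∀ r : Finset.Iic n, 1 ≤ r.1 → r.1 < n → y r ∉ T}} = B l := by
      ext x
      simp only [Set.mem_ofPred_eq, Preorder.frestrictLe_apply, Subtype.forall, Finset.mem_Iic, B]
      exact and_congr_right fun _ =>
        ⟨fun h r hr hr' => h r hr'.le hr hr', fun h r _ hr hr' => h r hr hr'⟩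
    have h2 : {x : ℕ → α | Preorder.frestrictLe n x ∈ {y : (_ : Finset.Iic n) → α |
        y ⟨n, Finset.mem_Iic.2 le_rfl⟩ = l ∧
        ∀ r : Finset.Iic n, 1 ≤ r.1 → r.1 < n → y r ∉ T} ∧ x (n + 1) = k} =
        B l ∩ {x | x (n + 1) = k} := by
      rw [← h1]; rfl
    rw [h2, h1] at h
    rw [Measure.real, h, ENNReal.toReal_mul,
      ENNReal.toReal_ofReal ((Matrix.mem_rowStochastic_iff_sum.1 P.2).1 l k)]
    rfl
  · intro l _ l' _ hll'
    refine Set.disjoint_left.2 fun x hx hx' => hll' ?_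
    exact hx.1.1.symm.trans hx'.1.1
  · exact fun l _ => (measurableSet_taboo T n l).inter hk

/-- The event of reaching `j` before the remaining elements of `T`. -/
theorem hasSum_tabooProb (P : Matrix.rowStochastic ℝ α) (a : α) (T : Finset α) {j : α}
    (hj : j ∈ T) :
    HasSum (fun n => tabooProb P a T (n + 1) j)
      ((chainLaw P a).real {x | ∃ n, x (n + 1) = j ∧ ∀ r, 1 ≤ r → r < n + 1 → x r ∉ T}) := by
  rw [Set.ofPred_exists]
  have hdisj : Pairwise (Function.onFun Disjoint
      fun n => {x : ℕ → α | x (n + 1) = j ∧ ∀ r, 1 ≤ r → r < n + 1 → x r ∉ T}) := by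
    intro n n' hnn'
    refine Set.disjoint_left.2 fun x hx hx' => ?_
    rcases lt_or_gt_of_ne hnn' with h | h
    · exact hx'.2 (n + 1) (by omega) (by omega) (hx.1 ▸ hj)
    · exact hx.2 (n' + 1) (by omega) (by omega) (hx'.1 ▸ hj)
  have hU := measure_iUnion (μ := chainLaw P a) hdisj fun n => measurableSet_taboo T (n + 1) j
  rw [Measure.real, hU, ENNReal.tsum_toReal_eq fun n => measure_ne_top _ _]
  exact ENNReal.hasSum_toReal (hU ▸ measure_ne_top _ _)

/-- A nonnegative supersolution of the hitting equations dominates the hitting probability. -/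
theorem sum_tabooProb_le (P : Matrix.rowStochastic ℝ α) (a : α) (T : Finset α) (j : α)
    (u : α → ℝ) (hu : ∀ k, 0 ≤ u k)
    (hsup : ∀ l ∉ T, P.1 l j + ∑ k ∈ Tᶜ, P.1 l k * u k ≤ u l) (N : ℕ) :
    ∑ n ∈ Finset.range N, tabooProb P a T (n + 1) j ≤
      P.1 a j + ∑ k ∈ Tᶜ, P.1 a k * u k := by
  -- The remainder weighted by `u` makes the left side nonincreasing in `N`, with equality at `N =
  -- 0`.
  have key (N : ℕ) : ∑ n ∈ Finset.range (N + 1), tabooProb P a T (n + 1) j +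
      ∑ k ∈ Tᶜ, tabooProb P a T (N + 1) k * u k ≤ P.1 a j + ∑ k ∈ Tᶜ, P.1 a k * u k := by
    induction N with
    | zero => simp [tabooProb_one]
    | succ N ih =>
      refine le_trans ?_ ih
      rw [Finset.sum_range_succ, add_assoc]
      refine add_le_add_right ?_ _
      calc tabooProb P a T (N + 1 + 1) j + ∑ k ∈ Tᶜ, tabooProb P a T (N + 1 + 1) k * u k
          = ∑ l ∈ Tᶜ, tabooProb P a T (N + 1) l * (P.1 l j + ∑ k ∈ Tᶜ, P.1 l k * u k) := by
            simp_rw [tabooProb_succ P a T (Nat.le_add_left 1 N), mul_add, Finset.sum_add_distrib,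
              Finset.sum_mul, Finset.mul_sum]
            rw [Finset.sum_comm]
            simp_rw [mul_assoc]
        _ ≤ _ := Finset.sum_le_sum fun l hl => mul_le_mul_of_nonneg_left
            (hsup l (Finset.mem_compl.1 hl)) (tabooProb_nonneg ..)
  have h0 : 0 ≤ ∑ k ∈ Tᶜ, tabooProb P a T (N + 1) k * u k :=
    Finset.sum_nonneg fun k _ => mul_nonneg (tabooProb_nonneg ..) (hu k)
  have h1 := key N
  rw [Finset.sum_range_succ] at h1
  linarith [tabooProb_nonneg P a T (N + 1) j]

end Taboo

/-- Putting `j` itself among the taboo states makes `n + 1` the first visit to `j`, so the events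
for different `n` are disjoint and their probabilities add. -/
theorem returnTime_lt_min_iff {α : Type*} [DecidableEq α] {i j o : α} (hij : i ≠ j) (hoj : o ≠ j)
    (x : ℕ → α) :
    returnTime j x < min (returnTime i x) (returnTime o x) ↔
      ∃ n, x (n + 1) = j ∧ ∀ r, 1 ≤ r → r < n + 1 → x r ∉ ({i, j, o} : Finset α) := by
  have hlt (k : α) (n : ℕ) : WithTop.some n < returnTime k x ↔ ∀ r, 1 ≤ r → r ≤ n → x r ≠ k := by
    rw [← not_le, returnTime, hittingAfter_le_iff]
    simp [and_imp]
  constructor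
  · intro h
    have hne : returnTime j x ≠ ⊤ := (h.trans_le le_top).ne
    obtain ⟨n, hn⟩ := WithTop.ne_top_iff_exists.1 hne
    rw [← hn, lt_min_iff, hlt, hlt] at h
    have h1 : hittingAfter (fun s (x : ℕ → α) => x s) {j} 1 x ≤ WithTop.some n := hn.symm.le
    rw [hittingAfter_le_iff] at h1
    obtain ⟨s, hs, hsj⟩ := h1
    rw [Set.mem_Icc] at hs
    have h2 : ∀ r, 1 ≤ r → r < s → x r ≠ j := by
      have : WithTop.some (s - 1) < returnTime j x := by
        rw [← hn]
        exact WithTop.coe_lt_coe.2 (by omega)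
      exact fun r hr hrs => (hlt j (s - 1)).1 this r hr (by omega)
    refine ⟨s - 1, ?_, fun r hr hrs => ?_⟩
    · rw [Nat.sub_add_cancel hs.1]; exact hsj
    · simp only [Finset.mem_insert, Finset.mem_singleton, not_or]
      exact ⟨h.1 r hr (by omega), h2 r hr (by omega), h.2 r hr (by omega)⟩
  · rintro ⟨n, hn, h⟩
    simp only [Finset.mem_insert, Finset.mem_singleton, not_or] at h
    have h1 : returnTime j x ≤ WithTop.some (n + 1) :=
      hittingAfter_le_of_mem (Nat.le_add_left 1 n) hn
    refine h1.trans_lt (lt_min ((hlt i _).2 fun r hr hrn => ?_) ((hlt o _).2 fun r hr hrn => ?_))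
    · rcases hrn.eq_or_lt with rfl | hrn
      · rw [hn]; exact hij.symm
      · exact (h r hr hrn).1
    · rcases hrn.eq_or_lt with rfl | hrn
      · rw [hn]; exact hoj.symm
      · exact (h r hr hrn).2.2

/-! ### Positivity of `Q` and its bound by supersolutions. -/

section Reaching

variable {Ω : Type*} [Fintype Ω] [DecidableEq Ω]

theorem hasSum_Q {S : Matrix Ω Ω ℝ} (hS : IsSubstochastic S) {i j : Ω} (hij : i ≠ j) :
    HasSum (fun n => tabooProb ⟨augment S, augment_mem_rowStochastic hS⟩ (some i)
      {some i, some j, none} (n + 1) (some j)) (Q S hS i j) := by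
  have hij' : (some i : Option Ω) ≠ some j := fun h => hij (Option.some_injective _ h)
  simp only [Q, returnTime_lt_min_iff hij' (Option.some_ne_none j).symm]
  exact hasSum_tabooProb _ _ _ (by simp)

/-- A set closed under the transitions of positive weight. -/
theorem mem_of_closed_of_isIrreducible {Ω : Type*} {S : Matrix Ω Ω ℝ} (hirr : S.IsIrreducible)
    {U : Set Ω}
    (hU : ∀ k ∈ U, ∀ l, 0 < S k l → l ∈ U) {i : Ω} (hi : i ∈ U) (j : Ω) : j ∈ U := by
  let := Matrix.toQuiver S
  obtain ⟨p, -⟩ := hirr.connected i j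
  induction p with
  | nil => exact hi
  | cons q e ih => exact hU _ ih _ e.down

theorem Q_pos {S : Matrix Ω Ω ℝ} (hS : IsSubstochastic S) (hirr : S.IsIrreducible) {i j : Ω}
    (hij : i ≠ j) : 0 < Q S hS i j := by
  set P : Matrix.rowStochastic ℝ (Option Ω) := ⟨augment S, augment_mem_rowStochastic hS⟩ with hP
  set T : Finset (Option Ω) := {some i, some j, none} with hT
  have hQ : HasSum (fun n => tabooProb P (some i) T (n + 1) (some j)) (Q S hS i j) :=
    hasSum_Q hS hij
  suffices h : ∃ n, 0 < tabooProb P (some i) T (n + 1) (some j) by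
    obtain ⟨n, hn⟩ := h
    exact hn.trans_le (le_hasSum hQ n fun m _ => tabooProb_nonneg ..)
  by_contra! hcon
  -- If `j` were never reached, the states reached under the taboo, together with the start `i`,
  -- would be closed under `S`; irreducibility then puts `j` among them.
  have hmem := mem_of_closed_of_isIrreducible hirr
    (U := {k | k = i ∨ ∃ n, 0 < tabooProb P (some i) T (n + 1) (some k)}) ?_ (i := i)
    (Or.inl rfl) j
  · rcases hmem with h | ⟨n, hn⟩
    · exact hij h.symm
    · exact (hcon n).not_gt hn
  · intro k hk l hkl
    right
    by_cases hki : k = i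
    · exact ⟨0, by rw [zero_add, tabooProb_one]; simpa [hP, augment, ← hki] using hkl⟩
    · obtain ⟨n, hn⟩ := hk.resolve_left hki
      have hkj : k ≠ j := fun h => (hcon n).not_gt (h ▸ hn)
      refine ⟨n + 1, ?_⟩
      rw [tabooProb_succ _ _ _ (by omega)]
      refine (mul_pos hn hkl).trans_le ?_
      refine Finset.single_le_sum (f := fun a => tabooProb P (some i) T (n + 1) a *
        P.1 a (some l)) (fun a _ => mul_nonneg (tabooProb_nonneg ..)
          ((Matrix.mem_rowStochastic_iff_sum.1 P.2).1 a _)) (a := some k) ?_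
      simp [hT, hki, hkj]

/-- A nonnegative supersolution `u` of the hitting equations normalised by `u j = 1` bounds
`Q_ij(S)` from above. -/
theorem Q_le_of_supersolution {S : Matrix Ω Ω ℝ} (hS : IsSubstochastic S) {i j : Ω} (hij : i ≠ j)
    (u : Ω → ℝ) (hu : ∀ k, 0 ≤ u k) (huj : u j = 1)
    (hsup : ∀ k, k ≠ i → k ≠ j → ∑ l, S k l * u l ≤ u k) :
    Q S hS i j ≤ ∑ l, S i l * u l := by
  set T : Finset (Option Ω) := {some i, some j, none} with hT
  have hsplit (k : Ω) : augment S (some k) (some j) +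
      ∑ l ∈ Tᶜ, augment S (some k) l * Option.elim l 0 u ≤ ∑ l, S k l * u l := by
    -- With `u` extended by `0` at `ω`, enlarging `Tᶜ` by `i` and `ω` only adds nonnegative terms.
    have h1 : ∑ l ∈ Tᶜ, augment S (some k) l * Option.elim l 0 u ≤
        ∑ l ∈ Finset.univ.erase (some j), augment S (some k) l * Option.elim l 0 u := by
      refine Finset.sum_le_sum_of_subset_of_nonneg (fun l hl => ?_) fun l _ _ => ?_
      · simp only [hT, Finset.mem_compl, Finset.mem_insert, not_or] at hl
        simp [hl.2.1]
      · rcases l with _ | l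
        · simp
        · exact mul_nonneg (hS.1 k l) (hu l)
    have h2 := Finset.add_sum_erase Finset.univ
      (fun l => augment S (some k) l * Option.elim l 0 u) (Finset.mem_univ (some j))
    rw [Fintype.sum_option] at h2
    simp only [Option.elim, mul_zero, zero_add, huj, mul_one] at h2
    calc _ ≤ _ := add_le_add_right h1 _
      _ = _ := h2
  refine le_of_tendsto' (hasSum_Q hS hij).tendsto_sum_nat fun N => ?_
  refine (sum_tabooProb_le _ _ T (some j) (fun l => Option.elim l 0 u) ?_ ?_ N).trans (hsplit i)
  · rintro (_ | k)
    · exact le_rfl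
    · exact hu k
  · rintro (_ | k) hk
    · simp [hT] at hk
    · simp only [hT, Finset.mem_insert, not_or, Option.some_inj] at hk
      exact (hsplit k).trans (hsup k hk.1 hk.2.1)

end Reaching

/-! ### The Green matrix of the chain killed at a state. -/

section Green

variable {Ω : Type*} [Fintype Ω] [DecidableEq Ω]

/-- Minimum principle for the chain killed at `i`. -/
theorem nonneg_of_supersolution {G S : Matrix Ω Ω ℝ} (hG : G ∈ Matrix.rowStochastic ℝ Ω)
    (hirr : S.IsIrreducible) (hSG : ∀ k l, S k l ≤ G k l) {i : Ω} {x : Ω → ℝ} (hi : 0 ≤ x i)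
    (hx : ∀ k, k ≠ i → ∑ l, G k l * x l ≤ x k) (k : Ω) : 0 ≤ x k := by
  rw [Matrix.mem_rowStochastic_iff_sum] at hG
  obtain ⟨k₀, -, hk₀⟩ := Finset.exists_min_image Finset.univ x ⟨i, Finset.mem_univ i⟩
  have hk₀ (l : Ω) : x k₀ ≤ x l := hk₀ l (Finset.mem_univ l)
  by_contra! hneg
  have hlt : x k₀ < 0 := (hk₀ k).trans_lt hneg
  -- Away from `i`, a minimiser dominates an average of values no smaller than its own, so its
  -- `S`-successors are minimisers too. The minimum spreads to `i`, where `x` is nonnegative.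
  have hU : i ∈ {k | x k = x k₀} := by
    refine mem_of_closed_of_isIrreducible hirr (U := {k | x k = x k₀}) (fun k hk l hkl => ?_)
      (i := k₀) rfl i
    have hki : k ≠ i := by rintro rfl; exact (hi.trans_eq hk).not_gt hlt
    have hsum : ∑ l, G k l * (x l - x k₀) ≤ 0 := by
      simp_rw [mul_sub, Finset.sum_sub_distrib, ← Finset.sum_mul, hG.2 k]
      have h1 : x k = x k₀ := hk
      linarith [hx k hki]
    have hnn (l : Ω) : 0 ≤ G k l * (x l - x k₀) := mul_nonneg (hG.1 k l) (sub_nonneg.2 (hk₀ l))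
    have h0 := (Finset.sum_eq_zero_iff_of_nonneg fun l _ => hnn l).1
      (le_antisymm hsum (Finset.sum_nonneg fun l _ => hnn l)) l (Finset.mem_univ l)
    have := (mul_eq_zero.1 h0).resolve_left (hkl.trans_le (hSG k l)).ne'
    exact sub_eq_zero.1 this
  exact (hi.trans_eq hU).not_gt hlt

/-- The Green matrix of the chain killed when it leaves `i`. -/
noncomputable def green (G : Matrix Ω Ω ℝ) (i : Ω) : Matrix Ω Ω ℝ := (1 - G.updateRow i 0)⁻¹

/-- This invariance makes the excursion measure affine in row `i`. -/
theorem green_updateRow (G : Matrix Ω Ω ℝ) (i : Ω) (r : Ω → ℝ) :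
    green (G.updateRow i r) i = green G i := by
  simp [green]

theorem sub_updateRow_mulVec_self (G : Matrix Ω Ω ℝ) (i : Ω) (x : Ω → ℝ) :
    ((1 - G.updateRow i 0).mulVec x) i = x i := by
  rw [Matrix.sub_mulVec, Matrix.one_mulVec, Pi.sub_apply, Matrix.mulVec, dotProduct]
  simp

theorem sub_updateRow_mulVec_of_ne (G : Matrix Ω Ω ℝ) {i k : Ω} (hk : k ≠ i) (x : Ω → ℝ) :
    ((1 - G.updateRow i 0).mulVec x) k = x k - ∑ l, G k l * x l := by
  rw [Matrix.sub_mulVec, Matrix.one_mulVec, Pi.sub_apply, Matrix.mulVec, dotProduct]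
  simp [hk]

/-- The minimum principle applied to a kernel vector and to its negative forces it to vanish. -/
theorem isUnit_sub_updateRow {G S : Matrix Ω Ω ℝ} (hG : G ∈ Matrix.rowStochastic ℝ Ω)
    (hirr : S.IsIrreducible) (hSG : ∀ k l, S k l ≤ G k l) (i : Ω) :
    IsUnit (1 - G.updateRow i 0) := by
  rw [← Matrix.mulVec_injective_iff_isUnit]
  have key (x : Ω → ℝ) (hx : (1 - G.updateRow i 0).mulVec x = 0) (k : Ω) : 0 ≤ x k := by
    refine nonneg_of_supersolution hG hirr hSG (i := i) ?_ (fun l hl => ?_) k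
    · rw [← sub_updateRow_mulVec_self G i x, hx, Pi.zero_apply]
    · have := sub_updateRow_mulVec_of_ne G hl x
      rw [hx, Pi.zero_apply] at this
      linarith
  intro x y hxy
  have h1 : (1 - G.updateRow i 0).mulVec (x - y) = 0 := by
    rw [Matrix.mulVec_sub, sub_eq_zero]; exact hxy
  have h2 : (1 - G.updateRow i 0).mulVec (y - x) = 0 := by
    rw [Matrix.mulVec_sub, sub_eq_zero]; exact hxy.symm
  funext k
  have h3 := key _ h1 k
  have h4 := key _ h2 k
  simp only [Pi.sub_apply] at h3 h4
  linarith

variable {G S : Matrix Ω Ω ℝ} (hG : G ∈ Matrix.rowStochastic ℝ Ω)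
  (hirr : S.IsIrreducible) (hSG : ∀ k l, S k l ≤ G k l)

include hG hirr hSG

theorem sub_updateRow_mul_green (i : Ω) : (1 - G.updateRow i 0) * green G i = 1 :=
  Matrix.mul_nonsing_inv _
    ((Matrix.isUnit_iff_isUnit_det _).1 (isUnit_sub_updateRow hG hirr hSG i))

theorem green_mul_sub_updateRow (i : Ω) : green G i * (1 - G.updateRow i 0) = 1 :=
  Matrix.nonsing_inv_mul _
    ((Matrix.isUnit_iff_isUnit_det _).1 (isUnit_sub_updateRow hG hirr hSG i))

theorem green_self (i m : Ω) : green G i i m = (1 : Matrix Ω Ω ℝ) i m := by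
  rw [← sub_updateRow_mul_green hG hirr hSG i]
  exact (sub_updateRow_mulVec_self G i fun k => green G i k m).symm

theorem green_of_ne {i k : Ω} (hk : k ≠ i) (m : Ω) :
    green G i k m = (1 : Matrix Ω Ω ℝ) k m + ∑ l, G k l * green G i l m := by
  rw [← sub_updateRow_mul_green hG hirr hSG i]
  have := sub_updateRow_mulVec_of_ne G hk fun k => green G i k m
  exact sub_eq_iff_eq_add.1 this.symm

theorem green_nonneg (i k m : Ω) : 0 ≤ green G i k m := by
  have h1 (a b : Ω) : 0 ≤ (1 : Matrix Ω Ω ℝ) a b := by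
    rw [Matrix.one_apply]; split_ifs <;> simp
  refine nonneg_of_supersolution hG hirr hSG (i := i) (x := fun k => green G i k m) ?_ ?_ k
  · rw [green_self hG hirr hSG]; exact h1 i m
  · intro k hk
    rw [green_of_ne hG hirr hSG hk m]
    linarith [h1 k m]

/-- The chain hits `i` almost surely. Algebraically, unit row sums make the constant `1` the
solution of the killed equation with source at `i`. -/
theorem green_apply_target (i k : Ω) : green G i k i = 1 := by
  have h1 : (1 - G.updateRow i 0).mulVec (fun _ => 1) = Pi.single i 1 := by
    funext k
    by_cases hk : k = i
    · subst hk
      rw [sub_updateRow_mulVec_self]; simp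
    · rw [sub_updateRow_mulVec_of_ne G hk]
      simp [hk, (Matrix.mem_rowStochastic_iff_sum.1 hG).2 k]
  have h2 : (green G i).mulVec (Pi.single i 1) = fun _ => 1 := by
    rw [← h1, Matrix.mulVec_mulVec, green_mul_sub_updateRow hG hirr hSG, Matrix.one_mulVec]
  have := congrFun h2 k
  simpa using this

end Green

/-! ### Invariant distributions as normalised excursion measures. -/

section Invariant

variable {Ω : Type*} [Fintype Ω] [DecidableEq Ω]

/-- The invariant measure of `G` with mass one at `i`: the expected number of visits during an
excursion from `i`. -/
noncomputable def excursionMeasure (G : Matrix Ω Ω ℝ) (i : Ω) : Ω → ℝ :=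
  Matrix.vecMul (G i) (green G i)

theorem excursionMeasure_apply (G : Matrix Ω Ω ℝ) (i m : Ω) :
    excursionMeasure G i m = ∑ k, G i k * green G i k m := rfl

theorem vecMul_eq_smul_add (G : Matrix Ω Ω ℝ) (i : Ω) (v : Ω → ℝ) :
    Matrix.vecMul v G = v i • G i + Matrix.vecMul v (G.updateRow i 0) := by
  funext m
  simp only [Matrix.vecMul, dotProduct, Pi.add_apply, Pi.smul_apply, smul_eq_mul]
  rw [← Finset.add_sum_erase _ _ (Finset.mem_univ i),
    ← Finset.add_sum_erase _ (fun k => v k * G.updateRow i 0 k m) (Finset.mem_univ i)]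
  simp only [Matrix.updateRow_self, Pi.zero_apply, mul_zero, zero_add]
  congr 1
  exact Finset.sum_congr rfl fun k hk => by
    rw [Matrix.updateRow_ne (Finset.ne_of_mem_erase hk)]

variable {G S : Matrix Ω Ω ℝ} (hG : G ∈ Matrix.rowStochastic ℝ Ω)
  (hirr : S.IsIrreducible) (hSG : ∀ k l, S k l ≤ G k l)

include hG hirr hSG

theorem excursionMeasure_nonneg (i m : Ω) : 0 ≤ excursionMeasure G i m :=
  Finset.sum_nonneg fun k _ => mul_nonneg ((Matrix.mem_rowStochastic_iff_sum.1 hG).1 i k)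
    (green_nonneg hG hirr hSG i k m)

theorem excursionMeasure_self (i : Ω) : excursionMeasure G i i = 1 := by
  simp [excursionMeasure_apply, green_apply_target hG hirr hSG,
    (Matrix.mem_rowStochastic_iff_sum.1 hG).2 i]

theorem vecMul_excursionMeasure (i : Ω) :
    Matrix.vecMul (excursionMeasure G i) G = excursionMeasure G i := by
  have h : Matrix.vecMul (excursionMeasure G i) (1 - G.updateRow i 0) = G i := by
    rw [excursionMeasure, Matrix.vecMul_vecMul, green_mul_sub_updateRow hG hirr hSG,
      Matrix.vecMul_one]
  rw [Matrix.vecMul_sub, Matrix.vecMul_one] at h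
  rw [vecMul_eq_smul_add G i, excursionMeasure_self hG hirr hSG, one_smul]
  nth_rw 1 [← h]
  abel

/-- Separating row `i` turns invariance into `p (1 - G.updateRow i 0) = p i • G i`, which the Green
matrix inverts. No sign of `p` enters. -/
theorem eq_smul_excursionMeasure (i : Ω) {p : Ω → ℝ} (hp : Matrix.vecMul p G = p) :
    p = p i • excursionMeasure G i := by
  have h : Matrix.vecMul p (1 - G.updateRow i 0) = p i • G i := by
    rw [Matrix.vecMul_sub, Matrix.vecMul_one]
    nth_rw 1 [← hp]
    rw [vecMul_eq_smul_add G i, add_sub_cancel_right]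
  rw [excursionMeasure, ← Matrix.smul_vecMul, ← h, Matrix.vecMul_vecMul,
    sub_updateRow_mul_green hG hirr hSG, Matrix.vecMul_one]

theorem sum_excursionMeasure_pos (i : Ω) : 0 < ∑ m, excursionMeasure G i m :=
  Finset.sum_pos' (fun m _ => excursionMeasure_nonneg hG hirr hSG i m)
    ⟨i, Finset.mem_univ i, by rw [excursionMeasure_self hG hirr hSG]; exact one_pos⟩

theorem isInvariantDistribution_iff (i : Ω) (p : Ω → ℝ) :
    IsInvariantDistribution G p ↔
      p = (∑ m, excursionMeasure G i m)⁻¹ • excursionMeasure G i := by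
  have hpos := sum_excursionMeasure_pos hG hirr hSG i
  constructor
  · rintro ⟨h1, h2⟩
    have h := eq_smul_excursionMeasure hG hirr hSG i h1
    rw [h] at h2
    simp only [Pi.smul_apply, smul_eq_mul, ← Finset.mul_sum] at h2
    rw [h, eq_inv_of_mul_eq_one_left h2]
  · rintro rfl
    refine ⟨by rw [Matrix.smul_vecMul, vecMul_excursionMeasure hG hirr hSG], ?_⟩
    simp only [Pi.smul_apply, smul_eq_mul, ← Finset.mul_sum]
    exact inv_mul_cancel₀ hpos.ne'

theorem existsUnique_isInvariantDistribution [Nonempty Ω] :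
    ∃! p, IsInvariantDistribution G p := by
  simp only [isInvariantDistribution_iff hG hirr hSG (Classical.arbitrary Ω)]
  exact ⟨_, rfl, fun _ h => h⟩

/-- Taking `m` itself as base point gives `p m` as the reciprocal of the total excursion mass. -/
theorem IsInvariantDistribution.pos {p : Ω → ℝ} (hp : IsInvariantDistribution G p) (m : Ω) :
    0 < p m := by
  have h := (isInvariantDistribution_iff hG hirr hSG m p).1 hp
  rw [h, Pi.smul_apply, excursionMeasure_self hG hirr hSG, smul_eq_mul, mul_one]
  exact inv_pos.2 (sum_excursionMeasure_pos hG hirr hSG m)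

theorem excursionMeasure_pos [Nonempty Ω] (i m : Ω) : 0 < excursionMeasure G i m := by
  obtain ⟨p, hp, -⟩ := existsUnique_isInvariantDistribution hG hirr hSG
  have h := congrFun ((isInvariantDistribution_iff hG hirr hSG i p).1 hp) m
  rw [Pi.smul_apply, smul_eq_mul] at h
  have := hp.pos hG hirr hSG m
  rw [h] at this
  exact pos_of_mul_pos_right this (inv_pos.2 (sum_excursionMeasure_pos hG hirr hSG i)).le

/-- An excursion of `G` from `i` reaches `j` with probability at least
`G_ij - S_ij + Q_ij(S)`. -/
theorem mul_green_le_excursionMeasure (hS : IsSubstochastic S) {i j : Ω} (hij : i ≠ j)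
    (m : Ω) :
    (G i j - S i j + Q S hS i j) * green G i j m ≤ excursionMeasure G i m := by
  have hN (k : Ω) : 0 ≤ green G i k m := green_nonneg hG hirr hSG i k m
  rcases (hN j).eq_or_lt with h0 | hpos
  · rw [← h0, mul_zero]
    exact excursionMeasure_nonneg hG hirr hSG i m
  have h1 (a b : Ω) : 0 ≤ (1 : Matrix Ω Ω ℝ) a b := by
    rw [Matrix.one_apply]; split_ifs <;> simp
  -- Away from `i`, column `m` of the Green matrix is a supersolution for `G`, hence for the smaller
  -- `S`. Dividing by its value at `j` gives the normalisation required to bound `Q`.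
  have hQ : Q S hS i j * green G i j m ≤ ∑ l, S i l * green G i l m := by
    have := Q_le_of_supersolution hS hij (fun k => green G i k m / green G i j m)
      (fun k => div_nonneg (hN k) hpos.le) (div_self hpos.ne') fun k hki _ => ?_
    · simp_rw [← mul_div_assoc, ← Finset.sum_div] at this
      exact (le_div_iff₀ hpos).1 this
    · simp_rw [← mul_div_assoc, ← Finset.sum_div]
      refine div_le_div_of_nonneg_right ?_ hpos.le
      rw [green_of_ne hG hirr hSG hki m]
      have := Finset.sum_le_sum fun l (_ : l ∈ Finset.univ) =>
        mul_le_mul_of_nonneg_right (hSG k l) (hN l)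
      linarith [h1 k m]
  -- The excess of `G` over `S` contributes at least its direct jump to `j`.
  have hD : (G i j - S i j) * green G i j m ≤ ∑ l, (G i l - S i l) * green G i l m :=
    Finset.single_le_sum (f := fun l => (G i l - S i l) * green G i l m)
      (fun l _ => mul_nonneg (sub_nonneg.2 (hSG i l)) (hN l)) (Finset.mem_univ j)
  simp_rw [sub_mul, Finset.sum_sub_distrib] at hD
  rw [excursionMeasure_apply]
  linarith

end Invariant

/-- The last hypothesis says `a' / a ≤ (c + t) / c`. -/
theorem log_sub_log_mem_Icc {a a' c t : ℝ} (ha : 0 < a) (hc : 0 < c) (ht : 0 ≤ t) (haa' : a ≤ a')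
    (h : c * (a' - a) ≤ t * a) :
    Real.log a' - Real.log a ∈ Set.Icc 0 (Real.log (c + t) - Real.log c) := by
  have ha' : 0 < a' := ha.trans_le haa'
  refine ⟨sub_nonneg.2 (Real.log_le_log ha haa'), ?_⟩
  rw [← Real.log_div ha'.ne' ha.ne', ← Real.log_div (by positivity) hc.ne']
  refine Real.log_le_log (by positivity) ?_
  rw [div_le_div_iff₀ ha hc]
  linarith

/-! ### Single-entry perturbations and telescoping. -/

section Perturbation

variable {Ω : Type*} [Fintype Ω] [DecidableEq Ω] [Nonempty Ω] {S : Matrix Ω Ω ℝ}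

/-- The effect on the invariant distribution of moving mass from `(i, i)` to `(i, j)`. -/
theorem abs_log_sub_log_le_of_updateRow {G G' : Matrix Ω Ω ℝ}
    (hG : G ∈ Matrix.rowStochastic ℝ Ω) (hG' : G' ∈ Matrix.rowStochastic ℝ Ω)
    (hS : IsSubstochastic S) (hirr : S.IsIrreducible)
    (hSG : ∀ k l, S k l ≤ G k l) (hSG' : ∀ k l, S k l ≤ G' k l) {i j : Ω} (hij : i ≠ j) {t : ℝ}
    (ht : 0 ≤ t) (hGG' : G' = G.updateRow i (G i + t • (Pi.single j 1 - Pi.single i 1)))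
    {p p' : Ω → ℝ} (hp : IsInvariantDistribution G p) (hp' : IsInvariantDistribution G' p')
    (m : Ω) :
    |Real.log (p' m) - Real.log (p m)| ≤
      Real.log (G' i j - S i j + Q S hS i j) - Real.log (G i j - S i j + Q S hS i j) := by
  set c := G i j - S i j + Q S hS i j with hc
  have hcpos : 0 < c := add_pos_of_nonneg_of_pos (sub_nonneg.2 (hSG i j)) (Q_pos hS hirr hij)
  have hct : G' i j - S i j + Q S hS i j = c + t := by
    have : G' i j = G i j + t := by simp [hGG', hij.symm]
    rw [this, hc]; ring
  set w := excursionMeasure G i with hw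
  set w' := excursionMeasure G' i with hw'
  have hdiff (m : Ω) : w' m - w m = t * (green G i j m - green G i i m) := by
    have hN : green G' i = green G i := by rw [hGG', green_updateRow]
    have hrow : G' i = G i + t • (Pi.single j 1 - Pi.single i 1) := by simp [hGG']
    rw [hw, hw', excursionMeasure, excursionMeasure, hN, hrow, Matrix.add_vecMul,
      Matrix.smul_vecMul, Matrix.sub_vecMul]
    simp
  have hmono (m : Ω) : w m ≤ w' m ∧ c * (w' m - w m) ≤ t * w m := by
    have hwm := excursionMeasure_nonneg hG hirr hSG i m
    rw [← sub_nonneg, hdiff]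
    -- At `m = i` both Green entries are `1` and nothing changes; elsewhere `green G i i m = 0`.
    by_cases him : i = m
    · subst him
      simp only [green_apply_target hG hirr hSG, sub_self, mul_zero, le_refl, true_and]
      positivity
    · have h0 : green G i i m = 0 := by rw [green_self hG hirr hSG, Matrix.one_apply_ne him]
      rw [h0, sub_zero]
      refine ⟨mul_nonneg ht (green_nonneg hG hirr hSG i j m), ?_⟩
      rw [mul_left_comm]
      exact mul_le_mul_of_nonneg_left
        (mul_green_le_excursionMeasure hG hirr hSG hS hij m) ht
  have hWpos := sum_excursionMeasure_pos hG hirr hSG i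
  have hWpos' := sum_excursionMeasure_pos hG' hirr hSG' i
  have hwpos := excursionMeasure_pos hG hirr hSG i m
  have hwpos' := excursionMeasure_pos hG' hirr hSG' i m
  have h1 := log_sub_log_mem_Icc hwpos hcpos ht (hmono m).1 (hmono m).2
  have h2 := log_sub_log_mem_Icc hWpos hcpos ht (Finset.sum_le_sum fun m _ => (hmono m).1) (by
    rw [← Finset.sum_sub_distrib, Finset.mul_sum, Finset.mul_sum]
    exact Finset.sum_le_sum fun m _ => (hmono m).2)
  rw [(isInvariantDistribution_iff hG hirr hSG i p).1 hp,
    (isInvariantDistribution_iff hG' hirr hSG' i p').1 hp', Pi.smul_apply, Pi.smul_apply,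
    smul_eq_mul, smul_eq_mul, Real.log_mul (inv_ne_zero hWpos.ne') hwpos.ne',
    Real.log_mul (inv_ne_zero hWpos'.ne') hwpos'.ne', Real.log_inv, Real.log_inv, hct, abs_le]
  -- Two numbers in the same interval `[0, L]` differ by at most `L`, so no factor `2` arises.
  constructor <;> linarith [h1.1, h1.2, h2.1, h2.2]

/-- Induction on the number of off-diagonal entries where `C` falls short of `G`: each step raises
one entry to its final value at the expense of the diagonal. As entries only rise, the sum needs no
absolute values. -/
theorem abs_log_sub_log_le_of_offDiag_le {G : Matrix Ω Ω ℝ} (hG : G ∈ Matrix.rowStochastic ℝ Ω)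
    (hS : IsSubstochastic S) (hirr : S.IsIrreducible) (hSG : ∀ k l, S k l ≤ G k l) {q : Ω → ℝ}
    (hq : IsInvariantDistribution G q) (m : Ω) (n : ℕ) :
    ∀ (C : Matrix Ω Ω ℝ), C ∈ Matrix.rowStochastic ℝ Ω → (∀ k l, S k l ≤ C k l) →
      (∀ k l, k ≠ l → C k l ≤ G k l) →
      Finset.card {x : Ω × Ω | x.1 ≠ x.2 ∧ C x.1 x.2 ≠ G x.1 x.2} = n →
      ∀ p, IsInvariantDistribution C p →
      |Real.log (q m) - Real.log (p m)| ≤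
        ∑ i, ∑ j with i ≠ j, (Real.log (G i j - S i j + Q S hS i j) -
          Real.log (C i j - S i j + Q S hS i j)) := by
  induction n with
  | zero =>
    intro C hC hSC hCG hcard p hp
    have hoff : ∀ k l, k ≠ l → C k l = G k l := by
      intro k l hkl
      by_contra hne
      rw [Finset.card_eq_zero, Finset.filter_eq_empty_iff] at hcard
      exact hcard (Finset.mem_univ (k, l)) ⟨hkl, hne⟩
    have hCG' : C = G := by
      ext k l
      by_cases hkl : k = l
      · subst hkl
        have h1 := (Matrix.mem_rowStochastic_iff_sum.1 hC).2 k
        have h2 := (Matrix.mem_rowStochastic_iff_sum.1 hG).2 k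
        rw [← Finset.add_sum_erase _ _ (Finset.mem_univ k)] at h1 h2
        have h3 : ∑ l ∈ Finset.univ.erase k, C k l = ∑ l ∈ Finset.univ.erase k, G k l :=
          Finset.sum_congr rfl fun l hl => hoff k l (Finset.ne_of_mem_erase hl).symm
        linarith
      · exact hoff k l hkl
    subst hCG'
    rw [(existsUnique_isInvariantDistribution hC hirr hSC).unique hq hp]
    simp
  | succ n ih =>
    intro C hC hSC hCG hcard p hp
    obtain ⟨⟨i, j⟩, hx⟩ := Finset.card_pos.1 (n.succ_pos.trans_eq hcard.symm)
    simp only [Finset.mem_filter, Finset.mem_univ, true_and] at hx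
    obtain ⟨hij, hne⟩ := hx
    have ht : 0 ≤ G i j - C i j := sub_nonneg.2 (hCG i j hij)
    set C' := C.updateRow i (C i + (G i j - C i j) • (Pi.single j 1 - Pi.single i 1)) with hC'
    have hC'off : ∀ k l, k ≠ l → C' k l = if k = i ∧ l = j then G i j else C k l := by
      intro k l hkl
      by_cases hki : k = i
      · subst hki
        by_cases hlj : l = j
        · subst hlj; simp [hC', hkl.symm]
        · simp [hC', hkl.symm, hlj]
      · simp [hC', hki]
    have hC'G : ∀ k l, k ≠ l → C' k l ≤ G k l := by
      intro k l hkl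
      rw [hC'off k l hkl]
      split_ifs with h
      · rw [h.1, h.2]
      · exact hCG k l hkl
    have hC'sum (k : Ω) : ∑ l, C' k l = 1 := by
      rw [← (Matrix.mem_rowStochastic_iff_sum.1 hC).2 k]
      by_cases hki : k = i
      · subst hki
        simp [hC', Finset.sum_add_distrib, ← Finset.mul_sum]
      · simp [hC', hki]
    -- The diagonal stays above `S`: with equal row sums and smaller off-diagonal entries, `C' k k ≥
    -- G k k`.
    have hSC' : ∀ k l, S k l ≤ C' k l := by
      intro k l
      by_cases hkl : k = l
      · subst hkl
        have h1 := hC'sum k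
        have h2 := (Matrix.mem_rowStochastic_iff_sum.1 hG).2 k
        rw [← Finset.add_sum_erase _ _ (Finset.mem_univ k)] at h1 h2
        have h3 : ∑ l ∈ Finset.univ.erase k, C' k l ≤ ∑ l ∈ Finset.univ.erase k, G k l :=
          Finset.sum_le_sum fun l hl => hC'G k l (Finset.ne_of_mem_erase hl).symm
        linarith [hSG k k]
      · rw [hC'off k l hkl]
        split_ifs with h
        · rw [h.1, h.2]; exact hSG i j
        · exact hSC k l
    have hC'stoch : C' ∈ Matrix.rowStochastic ℝ Ω :=
      Matrix.mem_rowStochastic_iff_sum.2 ⟨fun k l => (hS.1 k l).trans (hSC' k l), hC'sum⟩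
    obtain ⟨p', hp', -⟩ := existsUnique_isInvariantDistribution hC'stoch hirr hSC'
    have hcard' : Finset.card {x : Ω × Ω | x.1 ≠ x.2 ∧ C' x.1 x.2 ≠ G x.1 x.2} = n := by
      have : ({x : Ω × Ω | x.1 ≠ x.2 ∧ C' x.1 x.2 ≠ G x.1 x.2} : Finset (Ω × Ω)) =
          Finset.erase {x : Ω × Ω | x.1 ≠ x.2 ∧ C x.1 x.2 ≠ G x.1 x.2} (i, j) := by
        ext ⟨k, l⟩
        simp only [Finset.mem_filter, Finset.mem_univ, true_and, Finset.mem_erase, ne_eq,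
          Prod.mk.injEq]
        by_cases hkl : k = l
        · simp [hkl]
        · rw [hC'off k l hkl]
          split_ifs with h
          · simp [h.1, h.2]
          · simp [h]
      rw [this, Finset.card_erase_of_mem (by simp [hij, hne]), hcard, Nat.add_sub_cancel]
    have hstep := abs_log_sub_log_le_of_updateRow hC hC'stoch hS hirr hSC hSC' hij ht hC' hp hp' m
    have hrest := ih C' hC'stoch hSC' hC'G hcard' p' hp'
    have hsum : ∑ k, ∑ l with k ≠ l, (Real.log (C' k l - S k l + Q S hS k l) -
        Real.log (C k l - S k l + Q S hS k l)) =
        Real.log (C' i j - S i j + Q S hS i j) - Real.log (C i j - S i j + Q S hS i j) := by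
      rw [Finset.sum_eq_single i, Finset.sum_eq_single j]
      · intro l hl hlj
        rw [hC'off i l (Finset.mem_filter.1 hl).2, if_neg fun h => hlj h.2, sub_self]
      · intro h
        exact absurd (Finset.mem_filter.2 ⟨Finset.mem_univ j, hij⟩) h
      · intro k _ hki
        refine Finset.sum_eq_zero fun l hl => ?_
        rw [hC'off k l (Finset.mem_filter.1 hl).2, if_neg fun h => hki h.1, sub_self]
      · exact fun h => absurd (Finset.mem_univ i) h
    refine (abs_sub_le _ (Real.log (p' m)) _).trans
      ((add_le_add hrest (hstep.trans_eq hsum.symm)).trans_eq ?_)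
    simp_rw [← Finset.sum_add_distrib, sub_add_sub_cancel]

end Perturbation

/-! ### The common starting matrix and the final estimate. -/

/-- The stochastic matrix whose off-diagonal entries are the minima of those of `F` and `F'`. -/
noncomputable def offDiagMin {Ω : Type*} [Fintype Ω] [DecidableEq Ω] (F F' : Matrix Ω Ω ℝ) :
    Matrix Ω Ω ℝ := fun i j =>
  if i = j then 1 - ∑ l ∈ Finset.univ.erase i, min (F i l) (F' i l) else min (F i j) (F' i j)

theorem offDiagMin_spec {Ω : Type*} [Fintype Ω] [DecidableEq Ω] {F F' S : Matrix Ω Ω ℝ}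
    (hF : F ∈ Matrix.rowStochastic ℝ Ω) (hS : IsSubstochastic S) (hSF : ∀ i j, S i j ≤ F i j)
    (hSF' : ∀ i j, S i j ≤ F' i j) :
    offDiagMin F F' ∈ Matrix.rowStochastic ℝ Ω ∧ ∀ i j, S i j ≤ offDiagMin F F' i j := by
  have hle : ∀ i j, S i j ≤ offDiagMin F F' i j := by
    intro i j
    by_cases hij : i = j
    · subst hij
      have h2 := (Matrix.mem_rowStochastic_iff_sum.1 hF).2 i
      rw [← Finset.add_sum_erase _ _ (Finset.mem_univ i)] at h2
      have h3 : ∑ l ∈ Finset.univ.erase i, min (F i l) (F' i l) ≤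
          ∑ l ∈ Finset.univ.erase i, F i l := Finset.sum_le_sum fun l _ => min_le_left _ _
      simp only [offDiagMin, if_true]
      linarith [hSF i i]
    · simp only [offDiagMin, hij, if_false]
      exact le_min (hSF i j) (hSF' i j)
  refine ⟨Matrix.mem_rowStochastic_iff_sum.2 ⟨fun i j => (hS.1 i j).trans (hle i j), fun i => ?_⟩,
    hle⟩
  rw [← Finset.add_sum_erase _ _ (Finset.mem_univ i)]
  have : ∑ l ∈ Finset.univ.erase i, offDiagMin F F' i l =
      ∑ l ∈ Finset.univ.erase i, min (F i l) (F' i l) :=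
    Finset.sum_congr rfl fun l hl => if_neg (Finset.ne_of_mem_erase hl).symm
  rw [this]
  simp [offDiagMin]

end MarkovPerturbation

theorem mainTheorem1 {Ω : Type*} [Fintype Ω] [DecidableEq Ω] [Nonempty Ω]
    (F F' S : Matrix Ω Ω ℝ)
    (hF : F ∈ Matrix.rowStochastic ℝ Ω) (hF' : F' ∈ Matrix.rowStochastic ℝ Ω)
    (hS : MarkovPerturbation.IsSubstochastic S) (hirr : S.IsIrreducible)
    (hSF : ∀ i j, S i j ≤ F i j) (hSF' : ∀ i j, S i j ≤ F' i j) :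
    (∃! p, MarkovPerturbation.IsInvariantDistribution F p) ∧
    (∃! p, MarkovPerturbation.IsInvariantDistribution F' p) ∧
    (∀ i j, i ≠ j → 0 < MarkovPerturbation.Q S hS i j) ∧
    ∀ p p' : Ω → ℝ, MarkovPerturbation.IsInvariantDistribution F p →
      MarkovPerturbation.IsInvariantDistribution F' p' →
      ∀ m, 0 < p m ∧ 0 < p' m ∧
        |Real.log (p' m) - Real.log (p m)| ≤
          ∑ i, ∑ j with i ≠ j,
            |Real.log (F' i j - S i j + MarkovPerturbation.Q S hS i j) -
              Real.log (F i j - S i j + MarkovPerturbation.Q S hS i j)| := by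
  refine ⟨MarkovPerturbation.existsUnique_isInvariantDistribution hF hirr hSF,
    MarkovPerturbation.existsUnique_isInvariantDistribution hF' hirr hSF',
    fun i j hij => MarkovPerturbation.Q_pos hS hirr hij,
    fun p p' hp hp' m => ⟨hp.pos hF hirr hSF m, hp'.pos hF' hirr hSF' m, ?_⟩⟩
  obtain ⟨hC, hSC⟩ := MarkovPerturbation.offDiagMin_spec hF hS hSF hSF'
  obtain ⟨q, hq, -⟩ := MarkovPerturbation.existsUnique_isInvariantDistribution hC hirr hSC
  have h1 := MarkovPerturbation.abs_log_sub_log_le_of_offDiag_le hF hS hirr hSF hp m _ _ hC hSC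
    (fun k l hkl => by simp [MarkovPerturbation.offDiagMin, hkl]) rfl q hq
  have h2 := MarkovPerturbation.abs_log_sub_log_le_of_offDiag_le hF' hS hirr hSF' hp' m _ _ hC hSC
    (fun k l hkl => by simp [MarkovPerturbation.offDiagMin, hkl]) rfl q hq
  rw [abs_sub_comm] at h1
  refine (abs_sub_le _ (Real.log (q m)) _).trans ((add_le_add h2 h1).trans ?_)
  simp_rw [← Finset.sum_add_distrib]
  refine Finset.sum_le_sum fun i _ => Finset.sum_le_sum fun j hj => ?_
  have hij : i ≠ j := (Finset.mem_filter.1 hj).2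
  have hCij : MarkovPerturbation.offDiagMin F F' i j = min (F i j) (F' i j) := if_neg hij
  rw [hCij]
  -- The smaller of the two entries equals that of `offDiagMin`, so its difference vanishes and the
  -- other is the required absolute value.
  rcases le_total (F i j) (F' i j) with h | h
  · rw [min_eq_left h, sub_self, add_zero]
    exact le_abs_self _
  · rw [min_eq_right h, sub_self, zero_add, abs_sub_comm]
    exact le_abs_self _
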